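/- Let $\kappa>0$ and put $D_\kappa=\pi/\sqrt{\kappa}$. Let $(M,d)$ be a complete CAT$(\kappa)$ space with $\mathrm{diam}(M)<D_\kappa/2$. Let $A$ and $B$ be non-empty closed convex subsets of $M$ with $A\cap B\neq\emptyset$, where a subset $C\subseteq M$ is called convex if any two points of $C$ are joined by a geodesic of $M$ and the segment of every such geodesic is contained in $C$. For $x\in M$ and a non-empty closed convex set $C\subseteq M$, write $d(x,C)=\inf_{c\in C}d(x,c)$ and let $P_C(x)$ be the metric projection of $x$ onto $C$, that is, the unique point of $C$ with $d(x,P_C(x))=d(x,C)$. Let $x_0\in M$ be a starting point, and let $\{x_n\}$ be the sequence produced by the alternating projection method, \[ x_{2n-1}=P_A(x_{2n-2}),\qquad x_{2n}=P_B(x_{2n-1}),\qquad n=1,2,\dots . \] Then the following hold. (i) $\{x_n\}$ $\Delta$-converges to a point $x\in A\cap B$; that is, for every subsequence $\{x_{n_k}\}$ of $\{x_n\}$, the point $x$ is the unique minimizer over $M$ of the function $y\mapsto\limsup_{k\to\infty}d(y,x_{n_k})$. (ii) If $A$ and $B$ are boundedly regular, that is, if for every bounded set $S\subseteq M$ and every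 $\epsilon>0$ there is $\delta>0$ such that $d(x,A\cap B)\le\epsilon$ for all $x\in S$ with $\max\{d(x,A),d(x,B)\}\le\delta$, then $\{x_n\}$ converges to a point of $A\cap B$. (iii) If $A$ and $B$ are boundedly linearly regular, that is, if for every bounded set $S\subseteq M$ there is $k>0$ such that $d(x,A\cap B)\le k\max\{d(x,A),d(x,B)\}$ for all $x\in S$, then $\{x_n\}$ converges linearly to a point $x\in A\cap B$; that is, there are $K\ge 0$ and $\alpha\in[0,1)$ with $d(x_n,x)\le K\alpha^n$ for all $n$. -/

import Mathlib

open Set Filter Topology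

noncomputable section

namespace CATSpace

/-- `γ : [0,1] → X` (encoded as a map on `ℝ`, only its restriction to `[0,1]` matters) is a
geodesic joining `x` and `y`. -/
structure IsGeodesic {X : Type*} [Dist X] (γ : ℝ → X) (x y : X) : Prop where
  source : γ 0 = x
  target : γ 1 = y
  dist_eq : ∀ s ∈ Icc (0 : ℝ) 1, ∀ t ∈ Icc (0 : ℝ) 1, dist (γ s) (γ t) = dist x y * |s - t|

/-- `S` is a geodesic segment joining `x` and `y`. -/
def IsGeodesicSegment {X : Type*} [Dist X] (S : Set X) (x y : X) : Prop :=
  ∃ γ : ℝ → X, IsGeodesic γ x y ∧ S = γ '' Icc (0 : ℝ) 1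

/-- `X` is a `D`-geodesic space. -/
def IsDGeodesicSpace (X : Type*) [Dist X] (D : ℝ) : Prop :=
  ∀ x y : X, dist x y < D → ∃ γ : ℝ → X, IsGeodesic γ x y

/-- `C` is convex: any two of its points are joined by a geodesic of the ambient space, and the
segment of every such geodesic is contained in `C`. -/
def IsGeodesicallyConvex {X : Type*} [Dist X] (C : Set X) : Prop :=
  ∀ x ∈ C, ∀ y ∈ C,
    (∃ γ : ℝ → X, IsGeodesic γ x y) ∧
      ∀ γ : ℝ → X, IsGeodesic γ x y → γ '' Icc (0 : ℝ) 1 ⊆ C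

/-- `D_κ = π / √κ`. -/
def modelDiam (κ : ℝ) : ℝ := Real.pi / Real.sqrt κ

/-- The points of the model surface `M_κ²` (`κ > 0`): the unit sphere of `ℝ³`. -/
def ModelSurface (_κ : ℝ) : Type :=
  {u : EuclideanSpace ℝ (Fin 3) // inner ℝ u u = (1 : ℝ)}

/-- The distance of `M_κ²`: the angular distance of the unit sphere, multiplied by `1 / √κ`. -/
instance modelSurfaceDist (κ : ℝ) : Dist (ModelSurface κ) where
  dist u v := 1 / Real.sqrt κ * Real.arccos (inner ℝ u.1 v.1)

/-- A geodesic triangle: three vertices and three geodesic segments; `side i` joins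
`vertex i` and `vertex (i + 1)`, indices modulo `3`. -/
structure GeodesicTriangle (X : Type*) [Dist X] where
  vertex : Fin 3 → X
  side : Fin 3 → Set X
  isSegment : ∀ i, IsGeodesicSegment (side i) (vertex i) (vertex (i + 1))

/-- The perimeter of a geodesic triangle. -/
def GeodesicTriangle.perimeter {X : Type*} [Dist X] (T : GeodesicTriangle X) : ℝ :=
  ∑ i, dist (T.vertex i) (T.vertex (i + 1))

/-- `T'` is a comparison triangle in `M_κ²` for `T`. -/
def IsComparisonTriangle {X : Type*} [Dist X] {κ : ℝ} (T : GeodesicTriangle X)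
    (T' : GeodesicTriangle (ModelSurface κ)) : Prop :=
  ∀ i, dist (T.vertex i) (T.vertex (i + 1)) = dist (T'.vertex i) (T'.vertex (i + 1))

/-- `p'` on the `i`-th side of `T'` is a comparison point for `p` on the `i`-th side of `T`. -/
def IsComparisonPoint {X : Type*} [Dist X] {κ : ℝ} (T : GeodesicTriangle X)
    (T' : GeodesicTriangle (ModelSurface κ)) (i : Fin 3) (p : X) (p' : ModelSurface κ) : Prop :=
  p ∈ T.side i ∧ p' ∈ T'.side i ∧ dist p (T.vertex i) = dist p' (T'.vertex i)

/-- `T` satisfies the CAT(`κ`) inequality. -/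
def SatisfiesCATInequality {X : Type*} [Dist X] (κ : ℝ) (T : GeodesicTriangle X) : Prop :=
  ∀ T' : GeodesicTriangle (ModelSurface κ), IsComparisonTriangle T T' →
    ∀ (i j : Fin 3) (p q : X) (p' q' : ModelSurface κ),
      IsComparisonPoint T T' i p p' → IsComparisonPoint T T' j q q' → dist p q ≤ dist p' q'

/-- `X` is a CAT(`κ`) space (`κ > 0`). -/
structure IsCAT (κ : ℝ) (X : Type*) [MetricSpace X] : Prop where
  geodesic : IsDGeodesicSpace X (modelDiam κ)
  comparison : ∀ T : GeodesicTriangle X,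
    T.perimeter < 2 * modelDiam κ → SatisfiesCATInequality κ T

open Classical in
/-- The metric projection onto `C`: the unique point of `C` at distance `d(x, C)` from `x`.
If there is no unique such point, the value is `x` itself. -/
def metricProj {X : Type*} [MetricSpace X] (C : Set X) (x : X) : X :=
  if h : ∃! p, p ∈ C ∧ dist x p = Metric.infDist x C then h.choose else x

/-- `x 0, x 1, …` is produced by the alternating projection method from the starting point `x 0`:
`x (2n+1) = P_A (x (2n))` and `x (2n+2) = P_B (x (2n+1))` for all `n ≥ 0`. -/
def IsAlternatingProjection {X : Type*} [MetricSpace X] (A B : Set X) (x : ℕ → X) : Prop :=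
  ∀ n : ℕ, x (2 * n + 1) = metricProj A (x (2 * n)) ∧
    x (2 * n + 2) = metricProj B (x (2 * n + 1))

/-- `r(p, {xₙ}) = limsup d(p, xₙ)`, for a bounded sequence. -/
def radiusAt {X : Type*} [MetricSpace X] (p : X) (x : ℕ → X) : ℝ :=
  limsup (fun n => dist p (x n)) atTop

/-- The asymptotic radius of a bounded sequence. -/
def asymptoticRadius {X : Type*} [MetricSpace X] (x : ℕ → X) : ℝ :=
  ⨅ p : X, radiusAt p x

/-- The asymptotic center of a bounded sequence. -/
def asymptoticCenter {X : Type*} [MetricSpace X] (x : ℕ → X) : Set X :=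
  {p | radiusAt p x = asymptoticRadius x}

/-- The (bounded) sequence `x` `Δ`-converges to `p`: `p` is the unique asymptotic center of every
subsequence. -/
def DeltaConverges {X : Type*} [MetricSpace X] (x : ℕ → X) (p : X) : Prop :=
  ∀ φ : ℕ → ℕ, StrictMono φ → asymptoticCenter (x ∘ φ) = {p}

/-- `x` converges linearly to `p`. -/
def ConvergesLinearly {X : Type*} [MetricSpace X] (x : ℕ → X) (p : X) : Prop :=
  ∃ K α : ℝ, 0 ≤ K ∧ 0 ≤ α ∧ α < 1 ∧ ∀ n : ℕ, dist (x n) p ≤ K * α ^ n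

/-- `A` and `B` are boundedly regular. -/
def BoundedlyRegular {X : Type*} [MetricSpace X] (A B : Set X) : Prop :=
  ∀ S : Set X, Bornology.IsBounded S → ∀ ε : ℝ, 0 < ε → ∃ δ : ℝ, 0 < δ ∧
    ∀ x ∈ S, max (Metric.infDist x A) (Metric.infDist x B) ≤ δ → Metric.infDist x (A ∩ B) ≤ ε

/-- `A` and `B` are boundedly linearly regular. -/
def BoundedlyLinearlyRegular {X : Type*} [MetricSpace X] (A B : Set X) : Prop :=
  ∀ S : Set X, Bornology.IsBounded S → ∃ k : ℝ, 0 < k ∧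
    ∀ x ∈ S, Metric.infDist x (A ∩ B) ≤ k * max (Metric.infDist x A) (Metric.infDist x B)

end CATSpace

end

/-!
Comparing a triangle with its model on the sphere of radius `1 / √κ` bounds the cosine of the
scaled distance `√κ * d` from a vertex to a point of the opposite side. As all scaled distances
are smaller than `π / 2`, the bound at the midpoint makes the cosine of the distance to a point,
and of the limit superior of the distances to a sequence, so concave that its maximizing sequences
are Cauchy: this gives the metric projection and the asymptotic center. The derivative of the
bound at a projection gives the spherical Pythagorean inequality
`cos (√κ * d(x, c)) ≤ cos (√κ * d(x, P_C x)) * cos (√κ * d(P_C x, c))`.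

For the alternating projections and any `c ∈ A ∩ B` this makes `d(x n, c)` decreasing and the steps
`d(x n, x (n + 1))` tend to `0`, hence so do the distances to `A` and to `B`. The asymptotic center
of every subsequence then lies in `A ∩ B`, where the limit superior along a subsequence is the limit
along the whole sequence, so all these centers coincide. Under regularity `d(x n, A ∩ B)` tends to
`0`, which by monotonicity makes `x` Cauchy; under linear regularity the step is at least a fixed
fraction of `d(x n, A ∩ B)`, and the Pythagorean inequality makes
`sin² (√κ * d(x n, A ∩ B))` decrease geometrically.
-/

namespace CATSpace

open Real

section ModelSurface

lemma exists_cos_eq_of_triangle {a b c : ℝ} (hsub : |a - b| ≤ c) (hadd : c ≤ a + b)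
    (hper : a + b + c ≤ 2 * π) : ∃ φ, cos a * cos b + sin a * sin b * cos φ = cos c := by
  have hc : 0 ≤ c := (abs_nonneg _).trans hsub
  have hsub' : cos c ≤ cos (a - b) := by
    rw [← cos_abs (a - b)]
    exact cos_le_cos_of_nonneg_of_le_pi (abs_nonneg _) (by linarith) hsub
  have hadd' : cos (a + b) ≤ cos c := by
    rcases le_total (a + b) π with hab | hab
    · exact cos_le_cos_of_nonneg_of_le_pi hc hab hadd
    · rw [← cos_two_pi_sub (a + b)]
      exact cos_le_cos_of_nonneg_of_le_pi hc (by linarith) (by linarith)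
  refine mem_range_of_exists_le_of_exists_ge (by fun_prop) ⟨π, ?_⟩ ⟨0, ?_⟩
  · rw [cos_pi]; linarith [cos_add a b]
  · rw [cos_zero]; linarith [cos_sub a b]

/-- The point with parameter `t` on the great-circle arc of angle `θ` from the unit vector `u` to
the unit vector `v`. For `sin θ = 0` it has the junk value `0`. -/
noncomputable def greatCircleArc {V : Type*} [NormedAddCommGroup V] [InnerProductSpace ℝ V]
    (θ : ℝ) (u v : V) (t : ℝ) : V :=
  (sin θ)⁻¹ • (sin ((1 - t) * θ) • u + sin (t * θ) • v)

lemma inner_greatCircleArc {V : Type*} [NormedAddCommGroup V] [InnerProductSpace ℝ V]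
    {θ : ℝ} {u v : V} (hu : inner ℝ u u = (1 : ℝ)) (hv : inner ℝ v v = (1 : ℝ))
    (huv : inner ℝ u v = cos θ) (hθ : sin θ ≠ 0) (s t : ℝ) :
    inner ℝ (greatCircleArc θ u v s) (greatCircleArc θ u v t) = cos ((s - t) * θ) := by
  have hvu : inner ℝ v u = cos θ := by rw [real_inner_comm, huv]
  simp only [greatCircleArc, real_inner_smul_left, real_inner_smul_right, inner_add_left,
    inner_add_right, hu, hv, huv, hvu, sub_mul, one_mul, sin_sub, cos_sub]
  generalize s * θ = a
  generalize t * θ = b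
  field_simp
  linear_combination -(sin a * sin b) * sin_sq_add_cos_sq θ

variable {κ : ℝ}

lemma sqrt_mul_modelDiam (hκ : 0 < κ) : √κ * modelDiam κ = π :=
  mul_div_cancel₀ π (sqrt_pos.2 hκ).ne'

namespace ModelSurface

lemma norm_eq_one (u : ModelSurface κ) : ‖u.1‖ = 1 := by
  rw [norm_eq_sqrt_real_inner, u.2, sqrt_one]

lemma sqrt_mul_dist (hκ : 0 < κ) (u v : ModelSurface κ) :
    √κ * dist u v = arccos (inner ℝ u.1 v.1) := by
  change √κ * (1 / √κ * _) = _
  rw [one_div, mul_inv_cancel_left₀ (sqrt_pos.2 hκ).ne']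

lemma cos_sqrt_mul_dist (hκ : 0 < κ) (u v : ModelSurface κ) :
    cos (√κ * dist u v) = inner ℝ u.1 v.1 := by
  have hle := abs_real_inner_le_norm u.1 v.1
  rw [norm_eq_one, norm_eq_one, mul_one] at hle
  rw [sqrt_mul_dist hκ, cos_arccos (abs_le.1 hle).1 (abs_le.1 hle).2]

lemma dist_eq_of_inner_eq_cos (hκ : 0 < κ) {u v : ModelSurface κ} {r : ℝ} (hr : 0 ≤ r)
    (hrD : r ≤ modelDiam κ) (h : inner ℝ u.1 v.1 = cos (√κ * r)) : dist u v = r := by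
  refine mul_left_cancel₀ (sqrt_pos.2 hκ).ne' ?_
  rw [sqrt_mul_dist hκ, h, arccos_cos (by positivity)]
  rw [← sqrt_mul_modelDiam hκ]
  gcongr

lemma dist_self (u : ModelSurface κ) : dist u u = 0 := by
  change 1 / √κ * arccos (inner ℝ u.1 u.1) = 0
  rw [u.2, arccos_one, mul_zero]

lemma dist_nonneg (u v : ModelSurface κ) : 0 ≤ dist u v :=
  mul_nonneg (by positivity) (arccos_nonneg _)

lemma eq_of_dist_eq_zero (hκ : 0 < κ) {u v : ModelSurface κ} (h : dist u v = 0) : u = v := by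
  have hcos := cos_sqrt_mul_dist hκ u v
  rw [h, mul_zero, cos_zero] at hcos
  exact Subtype.ext
    ((inner_eq_one_iff_of_norm_eq_one u.norm_eq_one v.norm_eq_one).1 hcos.symm)

lemma exists_isGeodesic (hκ : 0 < κ) {u v : ModelSurface κ} (h : dist u v < modelDiam κ) :
    ∃ γ : ℝ → ModelSurface κ, IsGeodesic γ u v ∧ ∀ t,
      sin (√κ * dist u v) • (γ t).1 =
        sin ((1 - t) * (√κ * dist u v)) • u.1 + sin (t * (√κ * dist u v)) • v.1 := by
  rcases (dist_nonneg u v).eq_or_lt with h0 | hpos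
  · obtain rfl := eq_of_dist_eq_zero hκ h0.symm
    exact ⟨fun _ => u, ⟨rfl, rfl, fun _ _ _ _ => by rw [dist_self, zero_mul]⟩, by simp [dist_self]⟩
  set d := dist u v
  have hsin : sin (√κ * d) ≠ 0 := (sin_pos_of_pos_of_lt_pi (by positivity) (by
    rw [← sqrt_mul_modelDiam hκ]; gcongr)).ne'
  have hinner := inner_greatCircleArc u.2 v.2 (cos_sqrt_mul_dist hκ u v).symm hsin
  refine ⟨fun t => ⟨greatCircleArc (√κ * d) u.1 v.1 t, ?_⟩, ⟨?_, ?_, ?_⟩, fun t => ?_⟩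
  · rw [hinner, sub_self, zero_mul, cos_zero]
  · exact Subtype.ext (by simp [greatCircleArc, hsin])
  · exact Subtype.ext (by simp [greatCircleArc, hsin])
  · intro s hs01 t ht01
    have hst : |s - t| ≤ 1 :=
      abs_le.2 ⟨by linarith [hs01.1, ht01.2], by linarith [hs01.2, ht01.1]⟩
    refine dist_eq_of_inner_eq_cos hκ (by positivity) (by nlinarith) ?_
    rw [hinner, ← cos_abs, abs_mul, abs_of_pos (by positivity : 0 < √κ * d)]
    congr 1
    ring
  · exact smul_inv_smul₀ hsin _

lemma inner_vec_three (a b c a' b' c' : ℝ) :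
    inner ℝ !₂[a, b, c] !₂[a', b', c'] = a * a' + b * b' + c * c' := by
  simp [PiLp.inner_apply, Fin.sum_univ_three, mul_comm]

lemma exists_triangle (hκ : 0 < κ) {a b c : ℝ} (hab : a ≤ b + c) (hbc : b ≤ c + a)
    (hca : c ≤ a + b) (hper : a + b + c ≤ 2 * modelDiam κ) :
    ∃ u v w : ModelSurface κ, dist u v = a ∧ dist v w = b ∧ dist w u = c := by
  obtain ⟨φ, hφ⟩ : ∃ φ, cos (√κ * c) * cos (√κ * a) + sin (√κ * c) * sin (√κ * a) * cos φ =
      cos (√κ * b) := by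
    have hs := sqrt_nonneg κ
    refine exists_cos_eq_of_triangle ?_ ?_ ?_
    · rw [← mul_sub, abs_mul, abs_of_nonneg hs]
      gcongr
      exact abs_le.2 ⟨by linarith, by linarith⟩
    · rw [← mul_add]; gcongr
    · rw [← sqrt_mul_modelDiam hκ, ← mul_add, ← mul_add, mul_left_comm]
      gcongr
      linarith
  let u : ModelSurface κ := ⟨!₂[1, 0, 0], by simp only [inner_vec_three]; norm_num⟩
  let v : ModelSurface κ := ⟨!₂[cos (√κ * a), sin (√κ * a), 0], by
    rw [inner_vec_three]
    linear_combination sin_sq_add_cos_sq (√κ * a)⟩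
  let w : ModelSurface κ := ⟨!₂[cos (√κ * c), sin (√κ * c) * cos φ, sin (√κ * c) * sin φ], by
    rw [inner_vec_three]
    linear_combination sin (√κ * c) ^ 2 * sin_sq_add_cos_sq φ + sin_sq_add_cos_sq (√κ * c)⟩
  refine ⟨u, v, w, dist_eq_of_inner_eq_cos hκ (by linarith) (by linarith) ?_,
    dist_eq_of_inner_eq_cos hκ (by linarith) (by linarith) ?_,
    dist_eq_of_inner_eq_cos hκ (by linarith) (by linarith) ?_⟩
  · exact (inner_vec_three ..).trans (by ring)
  · exact (inner_vec_three ..).trans (by linear_combination hφ)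
  · exact (inner_vec_three ..).trans (by ring)

end ModelSurface

end ModelSurface

section Comparison

variable {X : Type*} [MetricSpace X] {κ : ℝ}

lemma IsCAT.dist_le_modelSurface_dist (hκ : 0 < κ) (hX : IsCAT κ X) {x y z : X} {γ : ℝ → X}
    (hγ : IsGeodesic γ y z) (hper : dist x y + dist y z + dist z x < 2 * modelDiam κ)
    {u v w : ModelSurface κ} {σ : ℝ → ModelSurface κ} (hσ : IsGeodesic σ v w)
    (huv : dist u v = dist x y) (hvw : dist v w = dist y z) (hwu : dist w u = dist z x)
    {t : ℝ} (ht : t ∈ Icc (0 : ℝ) 1) : dist x (γ t) ≤ dist u (σ t) := by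
  have hxy : dist x y < modelDiam κ := by linarith [dist_triangle_right x y z, dist_comm z x]
  have hzx : dist z x < modelDiam κ := by linarith [dist_triangle_right z x y, dist_comm z y]
  obtain ⟨γ₀, hγ₀⟩ := hX.geodesic x y hxy
  obtain ⟨γ₂, hγ₂⟩ := hX.geodesic z x hzx
  obtain ⟨σ₀, hσ₀, -⟩ := ModelSurface.exists_isGeodesic hκ (huv.trans_lt hxy)
  obtain ⟨σ₂, hσ₂, -⟩ := ModelSurface.exists_isGeodesic hκ (hwu.trans_lt hzx)
  let T : GeodesicTriangle X :=
    { vertex := ![x, y, z]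
      side := ![γ₀ '' Icc 0 1, γ '' Icc 0 1, γ₂ '' Icc 0 1]
      isSegment := fun
        | 0 => ⟨γ₀, hγ₀, rfl⟩
        | 1 => ⟨γ, hγ, rfl⟩
        | 2 => ⟨γ₂, hγ₂, rfl⟩ }
  let T' : GeodesicTriangle (ModelSurface κ) :=
    { vertex := ![u, v, w]
      side := ![σ₀ '' Icc 0 1, σ '' Icc 0 1, σ₂ '' Icc 0 1]
      isSegment := fun
        | 0 => ⟨σ₀, hσ₀, rfl⟩
        | 1 => ⟨σ, hσ, rfl⟩
        | 2 => ⟨σ₂, hσ₂, rfl⟩ }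
  have hTper : T.perimeter < 2 * modelDiam κ := by
    simpa [GeodesicTriangle.perimeter, Fin.sum_univ_three, T] using hper
  have hcomp : IsComparisonTriangle T T' := fun
    | 0 => huv.symm
    | 1 => hvw.symm
    | 2 => hwu.symm
  have h0 : (0 : ℝ) ∈ Icc (0 : ℝ) 1 := by simp
  have hvertex : IsComparisonPoint T T' 0 x u := by
    refine ⟨⟨0, h0, hγ₀.source⟩, ⟨0, h0, hσ₀.source⟩, ?_⟩
    exact (dist_self x).trans (ModelSurface.dist_self u).symm
  have hside : IsComparisonPoint T T' 1 (γ t) (σ t) := by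
    refine ⟨⟨t, ht, rfl⟩, ⟨t, ht, rfl⟩, ?_⟩
    change dist (γ t) y = dist (σ t) v
    rw [← hγ.source, ← hσ.source, hγ.dist_eq t ht 0 h0, hσ.dist_eq t ht 0 h0, hvw]
  exact hX.comparison T hTper T' hcomp 0 1 x (γ t) u (σ t) hvertex hside

theorem IsCAT.sin_mul_cos_le (hκ : 0 < κ) (hX : IsCAT κ X) {x y z : X} {γ : ℝ → X}
    (hγ : IsGeodesic γ y z) (hper : dist x y + dist y z + dist z x < 2 * modelDiam κ)
    {t : ℝ} (ht : t ∈ Icc (0 : ℝ) 1) :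
    sin ((1 - t) * (√κ * dist y z)) * cos (√κ * dist x y) +
        sin (t * (√κ * dist y z)) * cos (√κ * dist x z) ≤
      sin (√κ * dist y z) * cos (√κ * dist x (γ t)) := by
  obtain ⟨u, v, w, huv, hvw, hwu⟩ := ModelSurface.exists_triangle hκ
    (by linarith [dist_triangle_right x y z, dist_comm z x])
    (by linarith [dist_triangle_right y z x, dist_comm x y])
    (by linarith [dist_triangle_right z x y, dist_comm z y]) hper.le
  have hyz : dist y z < modelDiam κ := by linarith [dist_triangle_right y z x, dist_comm x y]
  obtain ⟨σ, hσ, hσ_eq⟩ := ModelSurface.exists_isGeodesic hκ (hvw.trans_lt hyz)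
  have hmodel : sin ((1 - t) * (√κ * dist y z)) * cos (√κ * dist x y) +
      sin (t * (√κ * dist y z)) * cos (√κ * dist x z) =
        sin (√κ * dist y z) * cos (√κ * dist u (σ t)) := by
    have := congrArg (inner ℝ u.1) (hσ_eq t)
    simp only [inner_add_right, real_inner_smul_right, real_inner_comm w.1 u.1,
      ← ModelSurface.cos_sqrt_mul_dist hκ, hvw, huv, hwu] at this
    rw [dist_comm x z, this]
  have hle : √κ * dist x (γ t) ≤ √κ * dist u (σ t) := by
    gcongr
    exact hX.dist_le_modelSurface_dist hκ hγ hper hσ huv hvw hwu ht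
  have hu_le : √κ * dist u (σ t) ≤ π := by
    rw [ModelSurface.sqrt_mul_dist hκ]
    exact arccos_le_pi _
  have hsin : 0 ≤ sin (√κ * dist y z) := sin_nonneg_of_nonneg_of_le_pi (by positivity) (by
    rw [← sqrt_mul_modelDiam hκ]; gcongr)
  rw [hmodel]
  exact mul_le_mul_of_nonneg_left (cos_le_cos_of_nonneg_of_le_pi (by positivity) hu_le hle) hsin

end Comparison

section StrictMaximizer

variable {X : Type*} [MetricSpace X]

lemma scaled_dist_le_two_mul_arccos {s a b M : ℝ} {y z : X} (hs : 0 ≤ s)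
    (hd : s * dist y z ≤ 2 * π) (hM : 0 < M) (h : a + b ≤ 2 * cos (s * dist y z / 2) * M) :
    s * dist y z ≤ 2 * arccos ((a + b) / (2 * M)) := by
  have hcos : (a + b) / (2 * M) ≤ cos (s * dist y z / 2) := by
    rw [div_le_iff₀ (by positivity)]
    linarith
  have := arccos_le_arccos hcos
  rw [arccos_cos (by positivity) (by linarith)] at this
  linarith

lemma cauchySeq_of_scaled_dist_le {s M : ℝ} {g : ℕ → ℝ} {u : ℕ → X} (hs : 0 < s) (hM : 0 < M)
    (hg : Tendsto g atTop (𝓝 M))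
    (hdist : ∀ m n, s * dist (u m) (u n) ≤ 2 * arccos ((g m + g n) / (2 * M))) : CauchySeq u := by
  have hsum : Tendsto (fun n : ℕ × ℕ => (g n.1 + g n.2) / (2 * M)) atTop (𝓝 1) := by
    rw [← prod_atTop_atTop_eq]
    have := ((hg.comp tendsto_fst).add (hg.comp tendsto_snd)).div_const (2 * M)
    rwa [← two_mul, div_self (by positivity)] at this
  have hangle := ((continuous_arccos.tendsto 1).comp hsum).const_mul (2 / s)
  rw [arccos_one, mul_zero] at hangle
  refine cauchySeq_iff_tendsto_dist_atTop_0.2 (squeeze_zero (fun _ => dist_nonneg) ?_ hangle)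
  intro n
  rw [Function.comp_apply, div_mul_eq_mul_div, le_div_iff₀ hs, mul_comm]
  exact hdist n.1 n.2

/- The midpoint inequality bounds the distance of two points by how far their values are from the
supremum, so every maximizing sequence is Cauchy; applied to the pair formed by the maximizer and
another point, it gives strictness. -/
theorem exists_forall_lt_of_midpoint {C D : Set X} (hCD : C ⊆ D) (hC : IsComplete C)
    {s : ℝ} (hs : 0 < s) (hd : ∀ y ∈ D, ∀ z ∈ D, s * dist y z ≤ π) {g : X → ℝ}
    (hg : Continuous g) (hbdd : BddAbove (g '' C)) (hpos : ∃ p ∈ C, 0 < g p)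
    (hret : ∀ q ∈ D, ∃ p ∈ C, g q ≤ g p)
    (hmid : ∀ y ∈ D, ∀ z ∈ D, ∃ m ∈ D, g y + g z ≤ 2 * cos (s * dist y z / 2) * g m) :
    ∃ p ∈ C, ∀ q ∈ D, q ≠ p → g q < g p := by
  obtain ⟨p₀, hp₀, hgp₀⟩ := hpos
  set M := sSup (g '' C)
  have hgM : ∀ q ∈ D, g q ≤ M := fun q hq =>
    let ⟨_, hp, hqp⟩ := hret q hq
    hqp.trans (le_csSup hbdd (mem_image_of_mem g hp))
  have hM : 0 < M := hgp₀.trans_le (hgM p₀ (hCD hp₀))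
  have hdist : ∀ y ∈ D, ∀ z ∈ D, s * dist y z ≤ 2 * arccos ((g y + g z) / (2 * M)) := by
    intro y hy z hz
    obtain ⟨m, hm, hle⟩ := hmid y hy z hz
    have hyz := hd y hy z hz
    have hcos : 0 ≤ cos (s * dist y z / 2) :=
      cos_nonneg_of_mem_Icc ⟨by linarith [pi_pos, mul_nonneg hs.le (dist_nonneg (x := y) (y := z))],
        by linarith⟩
    exact scaled_dist_le_two_mul_arccos hs.le (by linarith [pi_pos]) hM
      (hle.trans (mul_le_mul_of_nonneg_left (hgM m hm) (by positivity)))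
  obtain ⟨v, -, hv_lim, hv_mem⟩ :=
    exists_seq_tendsto_sSup ⟨g p₀, mem_image_of_mem g hp₀⟩ hbdd
  choose u huC hu using hv_mem
  have hgu : Tendsto (fun n => g (u n)) atTop (𝓝 M) := by simpa only [hu] using hv_lim
  have hu_cauchy : CauchySeq u := cauchySeq_of_scaled_dist_le hs hM hgu
    fun m n => hdist _ (hCD (huC m)) _ (hCD (huC n))
  obtain ⟨p, hpC, hp⟩ := cauchySeq_tendsto_of_isComplete hC huC hu_cauchy
  have hgp : g p = M := tendsto_nhds_unique ((hg.tendsto p).comp hp) hgu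
  refine ⟨p, hpC, fun q hq hqp => hgp.symm ▸ (hgM q hq).lt_of_ne fun hgq => hqp ?_⟩
  have hle := hdist q hq p (hCD hpC)
  rw [hgq, hgp, ← two_mul, div_self (by positivity), arccos_one, mul_zero] at hle
  exact dist_le_zero.1 (nonpos_of_mul_nonpos_right hle hs)

end StrictMaximizer

section SmallCAT

/-- A geodesic space of diameter less than `π / (2 s)` that satisfies the CAT(`s ^ 2`) inequality
for a vertex and a point of the opposite side. The inequality is in trigonometric form: for a
triangle in the sphere of curvature `s ^ 2` it is an equality. The parameter `R` bounds the
distances after scaling by `s`. -/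
structure IsSmallCAT (X : Type*) [MetricSpace X] (s R : ℝ) : Prop where
  scale_pos : 0 < s
  bound_lt : R < π / 2
  scaled_dist_le : ∀ x y : X, s * dist x y ≤ R
  exists_isGeodesic : ∀ x y : X, ∃ γ : ℝ → X, IsGeodesic γ x y
  sin_mul_cos_le : ∀ (x : X) {y z : X} {γ : ℝ → X}, IsGeodesic γ y z → ∀ t ∈ Icc (0 : ℝ) 1,
    sin ((1 - t) * (s * dist y z)) * cos (s * dist x y) +
        sin (t * (s * dist y z)) * cos (s * dist x z) ≤
      sin (s * dist y z) * cos (s * dist x (γ t))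

variable {X : Type*} [MetricSpace X]

theorem IsCAT.isSmallCAT {κ : ℝ} (hκ : 0 < κ) (hX : IsCAT κ X)
    (hdiam : Metric.ediam (univ : Set X) < ENNReal.ofReal (modelDiam κ / 2)) :
    IsSmallCAT X √κ (√κ * (Metric.ediam (univ : Set X)).toReal) := by
  have hs : 0 < √κ := sqrt_pos.2 hκ
  have hlt : (Metric.ediam (univ : Set X)).toReal < modelDiam κ / 2 :=
    (ENNReal.lt_ofReal_iff_toReal_lt hdiam.ne_top).1 hdiam
  have hdist (x y : X) : dist x y ≤ (Metric.ediam (univ : Set X)).toReal :=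
    Metric.dist_le_diam_of_mem' hdiam.ne_top (mem_univ x) (mem_univ y)
  refine ⟨hs, ?_, fun x y => mul_le_mul_of_nonneg_left (hdist x y) hs.le, fun x y => ?_, ?_⟩
  · calc √κ * (Metric.ediam (univ : Set X)).toReal
        < √κ * (modelDiam κ / 2) := mul_lt_mul_of_pos_left hlt hs
      _ = π / 2 := by rw [← mul_div_assoc, sqrt_mul_modelDiam hκ]
  · exact hX.geodesic x y (by linarith [hdist x y, dist_nonneg (x := x) (y := y)])
  · intro x y z γ hγ t ht
    exact hX.sin_mul_cos_le hκ hγ (by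
      linarith [hdist x y, hdist y z, hdist z x, dist_nonneg (x := x) (y := y)]) ht

namespace IsSmallCAT

variable {s R : ℝ}

lemma scaled_dist_nonneg (h : IsSmallCAT X s R) (x y : X) : 0 ≤ s * dist x y :=
  mul_nonneg h.scale_pos.le dist_nonneg

lemma scaled_dist_lt (h : IsSmallCAT X s R) (x y : X) : s * dist x y < π / 2 :=
  (h.scaled_dist_le x y).trans_lt h.bound_lt

lemma scaled_dist_le_pi (h : IsSmallCAT X s R) (x y : X) : s * dist x y ≤ π := by
  linarith [h.scaled_dist_lt x y, pi_pos]

lemma dist_le (h : IsSmallCAT X s R) (x y : X) : dist x y ≤ R / s := by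
  rw [le_div_iff₀ h.scale_pos, mul_comm]
  exact h.scaled_dist_le x y

lemma isBounded (h : IsSmallCAT X s R) (S : Set X) : Bornology.IsBounded S :=
  Metric.isBounded_iff.2 ⟨R / s, fun x _ y _ => h.dist_le x y⟩

lemma cos_scaled_dist_pos (h : IsSmallCAT X s R) (x y : X) : 0 < cos (s * dist x y) :=
  cos_pos_of_mem_Ioo ⟨by linarith [h.scaled_dist_nonneg x y, pi_pos], h.scaled_dist_lt x y⟩

lemma cos_le_cos_iff (h : IsSmallCAT X s R) {x y z w : X} :
    cos (s * dist x y) ≤ cos (s * dist z w) ↔ dist z w ≤ dist x y := by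
  rw [strictAntiOn_cos.le_iff_ge ⟨h.scaled_dist_nonneg x y, h.scaled_dist_le_pi x y⟩
    ⟨h.scaled_dist_nonneg z w, h.scaled_dist_le_pi z w⟩, mul_le_mul_iff_right₀ h.scale_pos]

lemma cos_add_cos_le (h : IsSmallCAT X s R) (x : X) {y z : X} {γ : ℝ → X}
    (hγ : IsGeodesic γ y z) :
    cos (s * dist x y) + cos (s * dist x z) ≤
      2 * cos (s * dist y z / 2) * cos (s * dist x (γ (1 / 2))) := by
  rcases eq_or_ne y z with rfl | hne
  · have hd := hγ.dist_eq 0 (by simp) (1 / 2) (by norm_num)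
    rw [dist_self, zero_mul, hγ.source] at hd
    rw [← dist_eq_zero.1 hd, dist_self, mul_zero, zero_div, cos_zero, mul_one, two_mul]
  · have hθ : 0 < s * dist y z / 2 := half_pos (mul_pos h.scale_pos (dist_pos.2 hne))
    have hsin : 0 < sin (s * dist y z / 2) :=
      sin_pos_of_pos_of_lt_pi hθ (by linarith [h.scaled_dist_le_pi y z, pi_pos])
    have hcat := h.sin_mul_cos_le x hγ (1 / 2) (by norm_num)
    rw [show s * dist y z = 2 * (s * dist y z / 2) by ring, sin_two_mul] at hcat
    refine le_of_mul_le_mul_left ?_ hsin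
    ring_nf at hcat ⊢
    exact hcat

end IsSmallCAT

end SmallCAT

section Projection

lemma le_cos_mul_of_forall_sin_le {θ a b : ℝ} (hθ : 0 < θ)
    (h : ∀ t ∈ Ioc (0 : ℝ) 1, sin ((1 - t) * θ) * a + sin (t * θ) * b ≤ sin θ * a) :
    b ≤ cos θ * a := by
  -- The left-hand side of `h` equals the right-hand side at `t = 0`, so its derivative there,
  -- `θ * (b - cos θ * a)`, is nonpositive.
  have hderiv : HasDerivAt (fun t : ℝ => sin ((1 - t) * θ) * a + sin (t * θ) * b)
      (θ * (b - cos θ * a)) 0 := by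
    have h₁ : HasDerivAt (fun t : ℝ => (1 - t) * θ) (-1 * θ) 0 :=
      ((hasDerivAt_id 0).const_sub 1).mul_const θ
    have h₂ : HasDerivAt (fun t : ℝ => t * θ) (1 * θ) 0 := (hasDerivAt_id 0).mul_const θ
    refine ((h₁.sin.mul_const a).fun_add (h₂.sin.mul_const b)).congr_deriv ?_
    rw [sub_zero, one_mul, zero_mul, cos_zero]
    ring
  have hnonpos : θ * (b - cos θ * a) ≤ 0 := by
    refine le_of_tendsto hderiv.tendsto_slope_zero_right ?_
    filter_upwards [Ioc_mem_nhdsGT one_pos] with t ht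
    simp only [zero_add, sub_zero, one_mul, zero_mul, sin_zero, add_zero, smul_eq_mul]
    exact mul_nonpos_of_nonneg_of_nonpos (inv_nonneg.2 ht.1.le) (by linarith [h t ht])
  linarith [nonpos_of_mul_nonpos_right hnonpos hθ]

namespace IsSmallCAT

variable {X : Type*} [MetricSpace X] {s R : ℝ} {C : Set X} {x : X}

theorem metricProj_spec (h : IsSmallCAT X s R) (hC : IsComplete C)
    (hconv : IsGeodesicallyConvex C) (hne : C.Nonempty) (x : X) :
    metricProj C x ∈ C ∧ dist x (metricProj C x) = Metric.infDist x C := by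
  obtain ⟨c₀, hc₀⟩ := hne
  obtain ⟨p, hp, hlt⟩ := exists_forall_lt_of_midpoint (g := fun q => cos (s * dist x q)) subset_rfl
    hC h.scale_pos (fun y _ z _ => h.scaled_dist_le_pi y z) (by fun_prop)
    ⟨1, forall_mem_image.2 fun _ _ => cos_le_one _⟩ ⟨c₀, hc₀, h.cos_scaled_dist_pos x c₀⟩
    (fun q hq => ⟨q, hq, le_rfl⟩) (fun y hy z hz => by
      obtain ⟨⟨γ, hγ⟩, hsub⟩ := hconv y hy z hz
      exact ⟨γ (1 / 2), hsub γ hγ (mem_image_of_mem γ (by norm_num)), h.cos_add_cos_le x hγ⟩)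
  have hmin : ∀ q ∈ C, q ≠ p → dist x p < dist x q := fun q hq hqp =>
    lt_of_not_ge fun hle => (hlt q hq hqp).not_ge (h.cos_le_cos_iff.2 hle)
  have hp_inf : dist x p = Metric.infDist x C := by
    refine le_antisymm ((Metric.le_infDist ⟨c₀, hc₀⟩).2 fun {q} hq => ?_)
      (Metric.infDist_le_dist_of_mem hp)
    rcases eq_or_ne q p with rfl | hqp
    exacts [le_rfl, (hmin q hq hqp).le]
  have hex : ∃! p, p ∈ C ∧ dist x p = Metric.infDist x C :=
    ⟨p, ⟨hp, hp_inf⟩, fun q hq => by_contra fun hqp =>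
      (hmin q hq.1 hqp).ne (hp_inf.trans hq.2.symm)⟩
  rw [metricProj, dif_pos hex]
  exact hex.choose_spec.1

theorem cos_dist_le_of_isNearest (h : IsSmallCAT X s R) (hconv : IsGeodesicallyConvex C)
    {p c : X} (hp : p ∈ C) (hmin : ∀ q ∈ C, dist x p ≤ dist x q) (hc : c ∈ C) :
    cos (s * dist x c) ≤ cos (s * dist x p) * cos (s * dist p c) := by
  rcases eq_or_ne p c with rfl | hpc
  · rw [dist_self, mul_zero, cos_zero, mul_one]
  obtain ⟨⟨γ, hγ⟩, hsub⟩ := hconv p hp c hc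
  rw [mul_comm (cos _) (cos _)]
  refine le_cos_mul_of_forall_sin_le (mul_pos h.scale_pos (dist_pos.2 hpc)) fun t ht => ?_
  have ht01 : t ∈ Icc (0 : ℝ) 1 := Ioc_subset_Icc_self ht
  have hnear : cos (s * dist x (γ t)) ≤ cos (s * dist x p) :=
    h.cos_le_cos_iff.2 (hmin _ (hsub γ hγ (mem_image_of_mem γ ht01)))
  exact (h.sin_mul_cos_le x hγ t ht01).trans (mul_le_mul_of_nonneg_left hnear
    (sin_nonneg_of_nonneg_of_le_pi (h.scaled_dist_nonneg p c) (h.scaled_dist_le_pi p c)))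

theorem cos_dist_le_metricProj (h : IsSmallCAT X s R) (hC : IsComplete C)
    (hconv : IsGeodesicallyConvex C) (x : X) {c : X} (hc : c ∈ C) :
    cos (s * dist x c) ≤
      cos (s * dist x (metricProj C x)) * cos (s * dist (metricProj C x) c) := by
  obtain ⟨hp, hdist⟩ := h.metricProj_spec hC hconv ⟨c, hc⟩ x
  exact h.cos_dist_le_of_isNearest hconv hp
    (fun q hq => hdist.trans_le (Metric.infDist_le_dist_of_mem hq)) hc

lemma dist_le_of_cos_le_mul (h : IsSmallCAT X s R) {y z w v : X}
    (hle : cos (s * dist x y) ≤ cos (s * dist z w) * cos (s * dist v y)) :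
    dist v y ≤ dist x y :=
  h.cos_le_cos_iff.1 (hle.trans
    (mul_le_of_le_one_left (h.cos_scaled_dist_pos v y).le (cos_le_one _)))

theorem dist_metricProj_le (h : IsSmallCAT X s R) (hC : IsComplete C)
    (hconv : IsGeodesicallyConvex C) (x : X) {c : X} (hc : c ∈ C) :
    dist (metricProj C x) c ≤ dist x c :=
  h.dist_le_of_cos_le_mul (h.cos_dist_le_metricProj hC hconv x hc)

end IsSmallCAT

end Projection

section AsymptoticCenter

variable {X : Type*} [MetricSpace X] {y : ℕ → X} {p q : X}

lemma isBoundedUnder_dist (hy : Bornology.IsBounded (range y)) (p : X) :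
    IsBoundedUnder (· ≤ ·) atTop fun n => dist p (y n) := by
  obtain ⟨r, hr⟩ := hy.subset_closedBall p
  exact isBoundedUnder_of ⟨r, fun n => (dist_comm p _).trans_le (hr (mem_range_self n))⟩

lemma isCoboundedUnder_dist (y : ℕ → X) (p : X) :
    IsCoboundedUnder (· ≤ ·) atTop fun n => dist p (y n) :=
  (isBoundedUnder_of ⟨0, fun _ => dist_nonneg⟩ :
    IsBoundedUnder (· ≥ ·) atTop fun n => dist p (y n)).isCoboundedUnder_le

lemma radiusAt_le_of_eventually_le {r : ℝ} (hr : ∀ᶠ n in atTop, dist p (y n) ≤ r) :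
    radiusAt p y ≤ r :=
  limsup_le_of_le (isCoboundedUnder_dist y p) hr

lemma radiusAt_nonneg (hy : Bornology.IsBounded (range y)) (p : X) : 0 ≤ radiusAt p y :=
  le_limsup_of_frequently_le (Frequently.of_forall fun _ => dist_nonneg) (isBoundedUnder_dist hy p)

lemma eventually_dist_lt {r : ℝ} (hy : Bornology.IsBounded (range y)) (hr : radiusAt p y < r) :
    ∀ᶠ n in atTop, dist p (y n) < r :=
  eventually_lt_of_limsup_lt hr (isBoundedUnder_dist hy p)

lemma radiusAt_le_add_dist (hy : Bornology.IsBounded (range y)) (p q : X) :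
    radiusAt p y ≤ radiusAt q y + dist p q := by
  refine le_of_forall_pos_le_add fun ε hε => radiusAt_le_of_eventually_le ?_
  filter_upwards [eventually_dist_lt hy (lt_add_of_pos_right (radiusAt q y) hε)] with n hn
  linarith [dist_triangle p q (y n)]

lemma continuous_radiusAt (hy : Bornology.IsBounded (range y)) :
    Continuous fun p => radiusAt p y :=
  (LipschitzWith.of_le_add (radiusAt_le_add_dist hy)).continuous

lemma asymptoticCenter_eq_singleton (hy : Bornology.IsBounded (range y))
    (hp : ∀ q, q ≠ p → radiusAt p y < radiusAt q y) : asymptoticCenter y = {p} := by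
  have hmin (q : X) : radiusAt p y ≤ radiusAt q y := by
    rcases eq_or_ne q p with rfl | hqp
    exacts [le_rfl, (hp q hqp).le]
  have : Nonempty X := ⟨p⟩
  have hrad : asymptoticRadius y = radiusAt p y :=
    le_antisymm (ciInf_le ⟨0, forall_mem_range.2 (radiusAt_nonneg hy)⟩ p) (le_ciInf hmin)
  refine eq_singleton_iff_unique_mem.2 ⟨hrad.symm, fun q hq => by_contra fun hqp => ?_⟩
  exact (hp q hqp).ne' (Eq.trans hq hrad)

lemma radiusAt_le_of_forall_mem_dist_le {C : Set X} (hy : Bornology.IsBounded (range y))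
    (hne : C.Nonempty) (hyC : Tendsto (fun n => Metric.infDist (y n) C) atTop (𝓝 0))
    (hpq : ∀ c ∈ C, dist q c ≤ dist p c) : radiusAt q y ≤ radiusAt p y := by
  refine le_of_forall_pos_le_add fun ε hε => radiusAt_le_of_eventually_le ?_
  filter_upwards [eventually_dist_lt hy (lt_add_of_pos_right (radiusAt p y) (half_pos hε)),
    hyC.eventually_lt_const (by linarith : (0 : ℝ) < ε / 4)] with n hpn hnC
  obtain ⟨c, hc, hnc⟩ := (Metric.infDist_lt_iff hne).1 hnC
  linarith [hpq c hc, dist_triangle q c (y n), dist_triangle p (y n) c, dist_comm c (y n)]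

lemma liminf_add_liminf_le_mul_liminf {u v w : ℕ → ℝ} {c : ℝ} (hc : 0 ≤ c)
    (hu : Bornology.IsBounded (range u)) (hv : Bornology.IsBounded (range v))
    (hw : Bornology.IsBounded (range w)) (h : ∀ n, u n + v n ≤ c * w n) :
    liminf u atTop + liminf v atTop ≤ c * liminf w atTop := by
  have hu_ge := hu.bddBelow.isBoundedUnder_of_range (f := atTop)
  have hv_ge := hv.bddBelow.isBoundedUnder_of_range (f := atTop)
  have hw_le := hw.bddAbove.isBoundedUnder_of_range (f := atTop)
  have hmono : Monotone (c * ·) := monotone_mul_left_of_nonneg hc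
  have hmul : c * liminf w atTop = liminf (fun n => c * w n) atTop :=
    hmono.map_liminf_of_continuousAt w (by fun_prop) hw_le.isCoboundedUnder_ge
      hw.bddBelow.isBoundedUnder_of_range
  rw [hmul]
  calc liminf u atTop + liminf v atTop
      ≤ liminf (u + v) atTop := le_liminf_add hu_ge hu.bddAbove.isBoundedUnder_of_range hv_ge
        hv.bddAbove.isBoundedUnder_of_range.isCoboundedUnder_ge
    _ ≤ liminf (fun n => c * w n) atTop := liminf_le_liminf (Eventually.of_forall h)
        (isBoundedUnder_ge_add hu_ge hv_ge)
        (hmono.isBoundedUnder_le_comp hw_le).isCoboundedUnder_ge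

lemma isBounded_range_cos {ι : Type*} (θ : ι → ℝ) :
    Bornology.IsBounded (range fun i => cos (θ i)) :=
  (Metric.isBounded_Icc (-1) 1).subset (range_subset_iff.2 fun _ => cos_mem_Icc _)

namespace IsSmallCAT

variable {s R : ℝ}

lemma cos_radiusAt_eq_liminf (h : IsSmallCAT X s R) (y : ℕ → X) (p : X) :
    cos (s * radiusAt p y) = liminf (fun n => cos (s * dist p (y n))) atTop := by
  have hs := h.scale_pos
  have hbdd := isBounded_range_cos fun n => s * dist p (y n)
  have hge := hbdd.bddBelow.isBoundedUnder_of_range (f := atTop)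
  have hco := (hbdd.bddAbove.isBoundedUnder_of_range (f := atTop)).isCoboundedUnder_ge
  have hmap := Antitone.map_liminf_of_continuousAt (f := fun u => arccos u / s)
    (fun _ _ huv => div_le_div_of_nonneg_right (arccos_le_arccos huv) hs.le) _
    (by fun_prop) hco hge
  have hdist : (fun u => arccos u / s) ∘ (fun n => cos (s * dist p (y n))) =
      fun n => dist p (y n) := funext fun n => by
    rw [Function.comp_apply, arccos_cos (h.scaled_dist_nonneg _ _) (h.scaled_dist_le_pi _ _),
      mul_div_cancel_left₀ _ hs.ne']
  rw [hdist] at hmap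
  rw [radiusAt, ← hmap, mul_div_cancel₀ _ hs.ne', cos_arccos]
  · exact le_liminf_of_le hco (Eventually.of_forall fun _ => neg_one_le_cos _)
  · exact liminf_le_of_le hge fun b hb => let ⟨_, hn⟩ := hb.exists; hn.trans (cos_le_one _)

lemma cos_radiusAt_add_cos_radiusAt_le (h : IsSmallCAT X s R) (y : ℕ → X) {p q : X} {γ : ℝ → X}
    (hγ : IsGeodesic γ p q) :
    cos (s * radiusAt p y) + cos (s * radiusAt q y) ≤
      2 * cos (s * dist p q / 2) * cos (s * radiusAt (γ (1 / 2)) y) := by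
  have hcos : 0 ≤ cos (s * dist p q / 2) :=
    cos_nonneg_of_mem_Icc ⟨by linarith [h.scaled_dist_nonneg p q, pi_pos],
      by linarith [h.scaled_dist_le_pi p q]⟩
  simp only [h.cos_radiusAt_eq_liminf y]
  refine liminf_add_liminf_le_mul_liminf (by positivity) (isBounded_range_cos _)
    (isBounded_range_cos _) (isBounded_range_cos _) fun n => ?_
  simpa only [dist_comm (y n)] using h.cos_add_cos_le (y n) hγ

theorem exists_forall_radiusAt_lt (h : IsSmallCAT X s R) {C : Set X} (hC : IsComplete C)
    (hconv : IsGeodesicallyConvex C) (hne : C.Nonempty)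
    (hyC : Tendsto (fun n => Metric.infDist (y n) C) atTop (𝓝 0)) :
    ∃ p ∈ C, ∀ q, q ≠ p → radiusAt p y < radiusAt q y := by
  have hs := h.scale_pos
  have hy : Bornology.IsBounded (range y) := h.isBounded _
  have hcont := continuous_radiusAt hy
  have hangle (p : X) : s * radiusAt p y ∈ Ico 0 (π / 2) := by
    refine ⟨mul_nonneg hs.le (radiusAt_nonneg hy p), lt_of_le_of_lt ?_ h.bound_lt⟩
    rw [← le_div_iff₀' hs]
    exact radiusAt_le_of_eventually_le (Eventually.of_forall fun n => h.dist_le p (y n))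
  have hanti {p q : X} (hpq : radiusAt p y ≤ radiusAt q y) :
      cos (s * radiusAt q y) ≤ cos (s * radiusAt p y) :=
    cos_le_cos_of_nonneg_of_le_pi (hangle p).1 (by linarith [(hangle q).2, pi_pos])
      (mul_le_mul_of_nonneg_left hpq hs.le)
  obtain ⟨c, hc⟩ := hne
  obtain ⟨p, hp, hlt⟩ := exists_forall_lt_of_midpoint (g := fun p => cos (s * radiusAt p y))
    (subset_univ C) hC hs (fun p _ q _ => h.scaled_dist_le_pi p q) (by fun_prop)
    ⟨1, forall_mem_image.2 fun _ _ => cos_le_one _⟩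
    ⟨c, hc, cos_pos_of_mem_Ioo ⟨by linarith [(hangle c).1, pi_pos], (hangle c).2⟩⟩
    (fun q _ => ⟨metricProj C q, (h.metricProj_spec hC hconv ⟨c, hc⟩ q).1,
      hanti (radiusAt_le_of_forall_mem_dist_le hy ⟨c, hc⟩ hyC
        fun _ => h.dist_metricProj_le hC hconv q)⟩)
    (fun p _ q _ => by
      obtain ⟨γ, hγ⟩ := h.exists_isGeodesic p q
      exact ⟨γ (1 / 2), mem_univ _, h.cos_radiusAt_add_cos_radiusAt_le y hγ⟩)
  exact ⟨p, hp, fun q hqp => lt_of_not_ge fun hle => (hlt q (mem_univ q) hqp).not_ge (hanti hle)⟩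

lemma mem_of_forall_radiusAt_lt (h : IsSmallCAT X s R) {C : Set X} (hC : IsComplete C)
    (hconv : IsGeodesicallyConvex C) (hne : C.Nonempty)
    (hyC : Tendsto (fun n => Metric.infDist (y n) C) atTop (𝓝 0))
    (hp : ∀ q, q ≠ p → radiusAt p y < radiusAt q y) : p ∈ C := by
  obtain ⟨q, hq, hqlt⟩ := h.exists_forall_radiusAt_lt hC hconv hne hyC
  by_contra hpC
  have hqp : q ≠ p := ne_of_mem_of_not_mem hq hpC
  exact (hp q hqp).not_gt (hqlt p hqp.symm)

end IsSmallCAT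

end AsymptoticCenter

section Fejer

variable {X : Type*} [MetricSpace X]

lemma cauchySeq_of_tendsto_dist {x y : ℕ → X} (hx : CauchySeq x)
    (hxy : Tendsto (fun n => dist (x n) (y n)) atTop (𝓝 0)) : CauchySeq y := by
  rw [cauchySeq_iff_tendsto_dist_atTop_0] at hx ⊢
  have hfst : Tendsto (fun n : ℕ × ℕ => dist (x n.1) (y n.1)) atTop (𝓝 0) :=
    hxy.comp (prod_atTop_atTop_eq (α := ℕ) (β := ℕ) ▸ tendsto_fst)
  have hsnd : Tendsto (fun n : ℕ × ℕ => dist (x n.2) (y n.2)) atTop (𝓝 0) :=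
    hxy.comp (prod_atTop_atTop_eq (α := ℕ) (β := ℕ) ▸ tendsto_snd)
  refine squeeze_zero (fun _ => dist_nonneg) (fun n => ?_)
    (by simpa only [add_zero] using (hfst.add hx).add hsnd)
  simpa only [dist_comm (y n.1)] using dist_triangle4 (y n.1) (x n.1) (x n.2) (y n.2)

/-- Fejér monotonicity of a sequence with respect to a set: no step increases the distance to a
point of the set. -/
def FejerMonotone (C : Set X) (x : ℕ → X) : Prop :=
  ∀ q ∈ C, Antitone fun n => dist (x n) q

namespace FejerMonotone

variable {C : Set X} {x : ℕ → X}

lemma isBounded_range (hx : FejerMonotone C x) (hne : C.Nonempty) :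
    Bornology.IsBounded (range x) := by
  obtain ⟨q, hq⟩ := hne
  exact Metric.isBounded_closedBall.subset (range_subset_iff.2 fun n => hx q hq (Nat.zero_le n))

lemma exists_tendsto_dist (hx : FejerMonotone C x) {q : X} (hq : q ∈ C) :
    ∃ r, Tendsto (fun n => dist (x n) q) atTop (𝓝 r) :=
  ⟨_, tendsto_atTop_ciInf (hx q hq) ⟨0, forall_mem_range.2 fun _ => dist_nonneg⟩⟩

lemma radiusAt_comp (hx : FejerMonotone C x) {q : X} (hq : q ∈ C) {φ : ℕ → ℕ}
    (hφ : StrictMono φ) : radiusAt q (x ∘ φ) = radiusAt q x := by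
  obtain ⟨r, hr⟩ := hx.exists_tendsto_dist hq
  simp only [dist_comm _ q] at hr
  exact (hr.comp hφ.tendsto_atTop).limsup_eq.trans hr.limsup_eq.symm

theorem exists_deltaConverges (hx : FejerMonotone C x)
    (hcenter : ∀ φ : ℕ → ℕ, StrictMono φ →
      ∃ p ∈ C, ∀ q, q ≠ p → radiusAt p (x ∘ φ) < radiusAt q (x ∘ φ)) :
    ∃ p ∈ C, DeltaConverges x p := by
  obtain ⟨p, hpC, hp⟩ := hcenter id strictMono_id
  refine ⟨p, hpC, fun φ hφ => ?_⟩
  obtain ⟨q, hqC, hq⟩ := hcenter φ hφ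
  obtain rfl : q = p := by
    by_contra hqp
    have hlt := hq p (Ne.symm hqp)
    rw [hx.radiusAt_comp hqC hφ, hx.radiusAt_comp hpC hφ] at hlt
    exact hlt.not_gt (hp q hqp)
  exact asymptoticCenter_eq_singleton
    ((hx.isBounded_range ⟨q, hqC⟩).subset (range_comp_subset_range φ x)) hq

lemma dist_le_two_mul_infDist (hx : FejerMonotone C x) (hne : C.Nonempty) {N m n : ℕ}
    (hm : N ≤ m) (hn : N ≤ n) : dist (x m) (x n) ≤ 2 * Metric.infDist (x N) C := by
  rw [← div_le_iff₀' two_pos, Metric.le_infDist hne]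
  intro q hq
  have hmq : dist (x m) q ≤ dist (x N) q := hx q hq hm
  have hnq : dist (x n) q ≤ dist (x N) q := hx q hq hn
  linarith [dist_triangle_right (x m) (x n) q]

theorem exists_tendsto (hx : FejerMonotone C x) (hC : IsComplete C) (hne : C.Nonempty)
    (hlim : Tendsto (fun n => Metric.infDist (x n) C) atTop (𝓝 0)) :
    ∃ p ∈ C, Tendsto x atTop (𝓝 p) := by
  have hcauchy : CauchySeq x := cauchySeq_of_le_tendsto_0 _
    (fun _ _ _ hm hn => hx.dist_le_two_mul_infDist hne hm hn)
    (by simpa only [mul_zero] using hlim.const_mul 2)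
  choose c hcC hc using fun n : ℕ => (Metric.infDist_lt_iff hne).1
    (lt_add_of_pos_right (Metric.infDist (x n) C) (Nat.one_div_pos_of_nat (α := ℝ) (n := n)))
  have hxc : Tendsto (fun n => dist (x n) (c n)) atTop (𝓝 0) :=
    squeeze_zero (fun _ => dist_nonneg) (fun n => (hc n).le)
      (by simpa only [add_zero] using hlim.add tendsto_one_div_add_atTop_nhds_zero_nat)
  obtain ⟨p, hpC, hp⟩ :=
    cauchySeq_tendsto_of_isComplete hC hcC (cauchySeq_of_tendsto_dist hcauchy hxc)
  exact ⟨p, hpC, (tendsto_iff_of_dist hxc).2 hp⟩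

theorem exists_convergesLinearly (hx : FejerMonotone C x) (hC : IsComplete C) (hne : C.Nonempty)
    {K α : ℝ} (hα₀ : 0 ≤ α) (hα₁ : α < 1) (hK : ∀ n, Metric.infDist (x n) C ≤ K * α ^ n) :
    ∃ p ∈ C, ConvergesLinearly x p := by
  have hlim : Tendsto (fun n => Metric.infDist (x n) C) atTop (𝓝 0) :=
    squeeze_zero (fun _ => Metric.infDist_nonneg) hK
      (by simpa using (tendsto_pow_atTop_nhds_zero_of_lt_one hα₀ hα₁).const_mul K)
  have hK₀ : 0 ≤ K := by simpa using Metric.infDist_nonneg.trans (hK 0)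
  obtain ⟨p, hpC, hp⟩ := hx.exists_tendsto hC hne hlim
  refine ⟨p, hpC, 2 * K, α, by positivity, hα₀, hα₁, fun n => ?_⟩
  have hle : dist (x n) p ≤ 2 * Metric.infDist (x n) C :=
    le_of_tendsto (tendsto_const_nhds.dist hp)
      (eventually_atTop.2 ⟨n, fun m hm => hx.dist_le_two_mul_infDist hne le_rfl hm⟩)
  linarith [hK n]

end FejerMonotone

lemma ConvergesLinearly.of_succ {x : ℕ → X} {p : X}
    (h : ConvergesLinearly (fun n => x (n + 1)) p) : ConvergesLinearly x p := by
  obtain ⟨K, α, hK, hα₀, hα₁, hle⟩ := h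
  -- The rate is enlarged so that it can be divided by also when `α = 0`.
  set β := (α + 1) / 2 with hβ
  have hβ₀ : 0 < β := by positivity
  refine ⟨K / β + dist (x 0) p, β, by positivity, hβ₀.le, by linarith, fun n => ?_⟩
  cases n with
  | zero => simpa using div_nonneg hK hβ₀.le
  | succ n =>
    calc dist (x (n + 1)) p ≤ K * α ^ n := hle n
      _ ≤ K * β ^ n := by gcongr; linarith
      _ = K / β * β ^ (n + 1) := by rw [pow_succ']; field_simp
      _ ≤ (K / β + dist (x 0) p) * β ^ (n + 1) := by
        gcongr
        exact le_add_of_nonneg_right dist_nonneg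

end Fejer

section SphericallyFejer

variable {X : Type*} [MetricSpace X] {s R : ℝ} {C : Set X} {x : ℕ → X}

/-- A quantitative form of Fejér monotonicity with respect to `C`: by the spherical Pythagorean
theorem, `x n`, `x (n + 1)` and any point of `C` form a triangle with an angle of at least `π / 2`
at `x (n + 1)`, as far as their distances scaled by `s` are concerned. -/
def SphericallyFejer (s : ℝ) (C : Set X) (x : ℕ → X) : Prop :=
  ∀ q ∈ C, ∀ n, cos (s * dist (x n) q) ≤
    cos (s * dist (x n) (x (n + 1))) * cos (s * dist (x (n + 1)) q)

namespace SphericallyFejer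

lemma fejerMonotone (hx : SphericallyFejer s C x) (h : IsSmallCAT X s R) : FejerMonotone C x :=
  fun q hq => antitone_nat_of_succ_le fun n => h.dist_le_of_cos_le_mul (hx q hq n)

theorem tendsto_dist_succ (hx : SphericallyFejer s C x) (h : IsSmallCAT X s R)
    (hne : C.Nonempty) : Tendsto (fun n => dist (x n) (x (n + 1))) atTop (𝓝 0) := by
  obtain ⟨q, hq⟩ := hne
  have hs := h.scale_pos
  obtain ⟨r, hr⟩ := (hx.fejerMonotone h).exists_tendsto_dist hq
  have hr₀ : 0 ≤ r := ge_of_tendsto' hr fun _ => dist_nonneg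
  have hrR : s * r ≤ R := le_of_tendsto' (hr.const_mul s) fun n => h.scaled_dist_le (x n) q
  have hcos_r : 0 < cos (s * r) :=
    cos_pos_of_mem_Ioo ⟨by linarith [mul_nonneg hs.le hr₀, pi_pos], hrR.trans_lt h.bound_lt⟩
  have hcos : Tendsto (fun n => cos (s * dist (x n) q)) atTop (𝓝 (cos (s * r))) :=
    (continuous_cos.tendsto _).comp (hr.const_mul s)
  have hratio := hcos.div (hcos.comp (tendsto_add_atTop_nat 1)) hcos_r.ne'
  rw [div_self hcos_r.ne'] at hratio
  have hone : Tendsto (fun n => cos (s * dist (x n) (x (n + 1)))) atTop (𝓝 1) :=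
    tendsto_of_tendsto_of_tendsto_of_le_of_le hratio tendsto_const_nhds
      (fun n => (div_le_iff₀ (h.cos_scaled_dist_pos _ q)).2 (hx q hq n)) fun _ => cos_le_one _
  have hangle := ((continuous_arccos.tendsto 1).comp hone).div_const s
  rw [arccos_one, zero_div] at hangle
  refine hangle.congr fun n => ?_
  rw [Function.comp_apply, arccos_cos (h.scaled_dist_nonneg _ _) (h.scaled_dist_le_pi _ _),
    mul_div_cancel_left₀ _ hs.ne']

lemma cos_infDist_le (hx : SphericallyFejer s C x) (h : IsSmallCAT X s R) (hne : C.Nonempty)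
    (n : ℕ) : cos (s * Metric.infDist (x n) C) ≤
      cos (s * dist (x n) (x (n + 1))) * cos (s * Metric.infDist (x (n + 1)) C) := by
  have hclosed : IsClosed {r | cos (s * r) ≤
      cos (s * dist (x n) (x (n + 1))) * cos (s * Metric.infDist (x (n + 1)) C)} :=
    isClosed_le (by fun_prop) continuous_const
  refine closure_minimal (image_subset_iff.2 fun q hq => (hx q hq n).trans ?_) hclosed
    ((Metric.isGLB_infDist hne).mem_closure (hne.image _))
  refine mul_le_mul_of_nonneg_left ?_ (h.cos_scaled_dist_pos _ _).le
  exact cos_le_cos_of_nonneg_of_le_pi (mul_nonneg h.scale_pos.le Metric.infDist_nonneg)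
    (h.scaled_dist_le_pi _ q)
    (mul_le_mul_of_nonneg_left (Metric.infDist_le_dist_of_mem hq) h.scale_pos.le)

end SphericallyFejer

lemma sin_sq_le_of_cos_le_mul {D D' e k R : ℝ} (hD : D ∈ Icc 0 (π / 2)) (hD' : D' ∈ Icc 0 R)
    (hR : R ≤ π / 2) (he : e ∈ Icc 0 (π / 2)) (hk : 0 < k) (hDe : D ≤ k * e)
    (hcos : cos D ≤ cos e * cos D') :
    sin D' ^ 2 ≤ (1 - (2 * cos R / (π * k)) ^ 2) * sin D ^ 2 := by
  have hcosD : 0 ≤ cos D := cos_nonneg_of_mem_Icc ⟨by linarith [hD.1, pi_pos], hD.2⟩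
  have hcosR : 0 ≤ cos R := cos_nonneg_of_mem_Icc ⟨by linarith [hD'.1, hD'.2, pi_pos], hR⟩
  have hcosD' : cos R ≤ cos D' :=
    cos_le_cos_of_nonneg_of_le_pi hD'.1 (by linarith [pi_pos]) hD'.2
  have hsinD : 0 ≤ sin D := sin_nonneg_of_nonneg_of_le_pi hD.1 (by linarith [hD.2, pi_pos])
  have hsin : 2 / (π * k) * sin D ≤ sin e :=
    calc 2 / (π * k) * sin D ≤ 2 / (π * k) * (k * e) := by
          gcongr
          exact (sin_le hD.1).trans hDe
      _ = 2 / π * e := by field_simp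
      _ ≤ sin e := mul_le_sin he.1 he.2
  have hsin_sq : (2 * cos R / (π * k) * sin D) ^ 2 ≤ (cos D' * sin e) ^ 2 := by
    have : 2 * cos R / (π * k) * sin D = cos R * (2 / (π * k) * sin D) := by ring
    rw [this]
    gcongr
    exact hcosR.trans hcosD'
  have hcos_sq : cos D ^ 2 ≤ (cos e * cos D') ^ 2 := by gcongr
  linear_combination hsin_sq + hcos_sq + sin_sq_add_cos_sq D' - sin_sq_add_cos_sq D +
    cos D' ^ 2 * sin_sq_add_cos_sq e

namespace SphericallyFejer

theorem exists_infDist_le_geometric (hx : SphericallyFejer s C x) (h : IsSmallCAT X s R)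
    (hne : C.Nonempty) {k : ℝ} (hk : 0 < k)
    (hle : ∀ n, Metric.infDist (x n) C ≤ k * dist (x n) (x (n + 1))) :
    ∃ α, 0 ≤ α ∧ α < 1 ∧ ∀ n, Metric.infDist (x n) C ≤ π / (2 * s) * α ^ n := by
  have hs := h.scale_pos
  have hD (n : ℕ) : s * Metric.infDist (x n) C ∈ Icc 0 R := by
    obtain ⟨q, hq⟩ := hne
    exact ⟨mul_nonneg hs.le Metric.infDist_nonneg, (mul_le_mul_of_nonneg_left
      (Metric.infDist_le_dist_of_mem hq) hs.le).trans (h.scaled_dist_le _ q)⟩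
  have hD_half (n : ℕ) : s * Metric.infDist (x n) C ∈ Icc 0 (π / 2) :=
    Icc_subset_Icc_right h.bound_lt.le (hD n)
  have hcosR : 0 < cos R :=
    cos_pos_of_mem_Ioo ⟨by linarith [(hD 0).1, (hD 0).2, pi_pos], h.bound_lt⟩
  set β := max 0 (1 - (2 * cos R / (π * k)) ^ 2)
  have hβ₀ : 0 ≤ β := le_max_left _ _
  have hβ₁ : β < 1 := max_lt one_pos (sub_lt_self 1 (by positivity))
  have hstep (n : ℕ) : sin (s * Metric.infDist (x (n + 1)) C) ^ 2 ≤
      β * sin (s * Metric.infDist (x n) C) ^ 2 := by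
    refine (sin_sq_le_of_cos_le_mul (hD_half n) (hD (n + 1)) h.bound_lt.le
      ⟨h.scaled_dist_nonneg _ _, (h.scaled_dist_lt _ _).le⟩ hk ?_
      (hx.cos_infDist_le h hne n)).trans ?_
    · rw [mul_left_comm]
      exact mul_le_mul_of_nonneg_left (hle n) hs.le
    · exact mul_le_mul_of_nonneg_right (le_max_right _ _) (sq_nonneg _)
  refine ⟨√β, sqrt_nonneg β, (sqrt_lt' one_pos).2 (by rwa [one_pow]), fun n => ?_⟩
  have hsin_sq : sin (s * Metric.infDist (x n) C) ^ 2 ≤ (√β ^ n) ^ 2 :=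
    calc sin (s * Metric.infDist (x n) C) ^ 2
        ≤ β ^ n * sin (s * Metric.infDist (x 0) C) ^ 2 :=
          le_geom (u := fun n => sin (s * Metric.infDist (x n) C) ^ 2) hβ₀ n fun m _ => hstep m
      _ ≤ β ^ n := mul_le_of_le_one_right (by positivity) (sin_sq_le_one _)
      _ = (√β ^ n) ^ 2 := by rw [pow_right_comm, sq_sqrt hβ₀]
  have hsin := (mul_le_sin (hD n).1 (hD_half n).2).trans
    (le_of_sq_le_sq hsin_sq (by positivity))
  have hscale : Metric.infDist (x n) C =
      π / (2 * s) * (2 / π * (s * Metric.infDist (x n) C)) := by field_simp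
  rw [hscale]
  gcongr

end SphericallyFejer

end SphericallyFejer

section AlternatingProjection

variable {X : Type*} [MetricSpace X] {A B : Set X} {x : ℕ → X} {s R : ℝ}

lemma isComplete_inter (hA : IsComplete A) (hB : IsClosed B) : IsComplete (A ∩ B) := by
  intro f hf hfAB
  rw [le_principal_iff, inter_mem_iff] at hfAB
  obtain ⟨a, ha, hfa⟩ := hA f hf (le_principal_iff.2 hfAB.1)
  have := hf.1
  exact ⟨a, ⟨ha, hB.mem_of_tendsto (f := id) hfa hfAB.2⟩, hfa⟩

lemma BoundedlyRegular.tendsto_infDist (hreg : BoundedlyRegular A B)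
    (hx : Bornology.IsBounded (range x))
    (hlim : Tendsto (fun n => max (Metric.infDist (x n) A) (Metric.infDist (x n) B)) atTop (𝓝 0)) :
    Tendsto (fun n => Metric.infDist (x n) (A ∩ B)) atTop (𝓝 0) := by
  refine tendsto_order.2 ⟨fun r hr => Eventually.of_forall fun _ =>
    hr.trans_le Metric.infDist_nonneg, fun r hr => ?_⟩
  obtain ⟨δ, hδ, hle⟩ := hreg (range x) hx (r / 2) (half_pos hr)
  filter_upwards [hlim.eventually_le_const hδ] with n hn
  exact (hle (x n) (mem_range_self n) hn).trans_lt (half_lt_self hr)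

namespace IsAlternatingProjection

lemma succ_eq (hx : IsAlternatingProjection A B x) (n : ℕ) :
    x (n + 1) = metricProj A (x n) ∧ x (n + 2) = metricProj B (x (n + 1)) ∨
      x (n + 1) = metricProj B (x n) ∧ x (n + 2) = metricProj A (x (n + 1)) := by
  rcases Nat.even_or_odd' n with ⟨m, rfl | rfl⟩
  · exact .inl (hx m)
  · exact .inr ⟨(hx m).2, (hx (m + 1)).1⟩

variable (hx : IsAlternatingProjection A B x) (h : IsSmallCAT X s R) (hA' : IsComplete A)
  (hB' : IsComplete B) (hA : IsGeodesicallyConvex A) (hB : IsGeodesicallyConvex B)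
include hx h hA' hB' hA hB

theorem sphericallyFejer : SphericallyFejer s (A ∩ B) x := by
  intro q hq n
  rcases hx.succ_eq n with ⟨hn, -⟩ | ⟨hn, -⟩ <;> rw [hn]
  exacts [h.cos_dist_le_metricProj hA' hA _ hq.1, h.cos_dist_le_metricProj hB' hB _ hq.2]

variable (hAB : (A ∩ B).Nonempty)
include hAB

lemma max_infDist_le (n : ℕ) :
    max (Metric.infDist (x (n + 1)) A) (Metric.infDist (x (n + 1)) B) ≤
      dist (x (n + 1)) (x (n + 2)) := by
  have hprojA (z : X) := h.metricProj_spec hA' hA hAB.left z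
  have hprojB (z : X) := h.metricProj_spec hB' hB hAB.right z
  rcases hx.succ_eq n with ⟨h₁, h₂⟩ | ⟨h₁, h₂⟩
  · refine max_le ?_ (h₂ ▸ (hprojB _).2.ge)
    rw [Metric.infDist_zero_of_mem (h₁ ▸ (hprojA _).1)]
    exact dist_nonneg
  · refine max_le (h₂ ▸ (hprojA _).2.ge) ?_
    rw [Metric.infDist_zero_of_mem (h₁ ▸ (hprojB _).1)]
    exact dist_nonneg

lemma tendsto_max_infDist :
    Tendsto (fun n => max (Metric.infDist (x n) A) (Metric.infDist (x n) B)) atTop (𝓝 0) := by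
  have hstep := (hx.sphericallyFejer h hA' hB' hA hB).tendsto_dist_succ h hAB
  exact (tendsto_add_atTop_iff_nat 1).1 (squeeze_zero
    (fun _ => le_max_of_le_left Metric.infDist_nonneg)
    (hx.max_infDist_le h hA' hB' hA hB hAB) ((tendsto_add_atTop_iff_nat 1).2 hstep))

theorem exists_deltaConverges : ∃ p ∈ A ∩ B, DeltaConverges x p := by
  have hmax := hx.tendsto_max_infDist h hA' hB' hA hB hAB
  have hlimA : Tendsto (fun n => Metric.infDist (x n) A) atTop (𝓝 0) :=
    squeeze_zero (fun _ => Metric.infDist_nonneg) (fun _ => le_max_left _ _) hmax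
  have hlimB : Tendsto (fun n => Metric.infDist (x n) B) atTop (𝓝 0) :=
    squeeze_zero (fun _ => Metric.infDist_nonneg) (fun _ => le_max_right _ _) hmax
  refine ((hx.sphericallyFejer h hA' hB' hA hB).fejerMonotone h).exists_deltaConverges
    fun φ hφ => ?_
  obtain ⟨p, hpA, hp⟩ :=
    h.exists_forall_radiusAt_lt hA' hA hAB.left (hlimA.comp hφ.tendsto_atTop)
  exact ⟨p, ⟨hpA, h.mem_of_forall_radiusAt_lt hB' hB hAB.right
    (hlimB.comp hφ.tendsto_atTop) hp⟩, hp⟩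

theorem exists_tendsto (hreg : BoundedlyRegular A B) : ∃ p ∈ A ∩ B, Tendsto x atTop (𝓝 p) :=
  ((hx.sphericallyFejer h hA' hB' hA hB).fejerMonotone h).exists_tendsto
    (isComplete_inter hA' hB'.isClosed) hAB
    (hreg.tendsto_infDist (h.isBounded _) (hx.tendsto_max_infDist h hA' hB' hA hB hAB))

theorem exists_convergesLinearly (hreg : BoundedlyLinearlyRegular A B) :
    ∃ p ∈ A ∩ B, ConvergesLinearly x p := by
  obtain ⟨k, hk, hle⟩ := hreg univ (h.isBounded univ)
  -- Only from `x 1` on does the iterate lie in one of the two sets, so that its distance to the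
  -- other one is the length of the next step.
  have hy : SphericallyFejer s (A ∩ B) fun n => x (n + 1) :=
    fun q hq n => hx.sphericallyFejer h hA' hB' hA hB q hq (n + 1)
  have hstep (n : ℕ) : Metric.infDist (x (n + 1)) (A ∩ B) ≤ k * dist (x (n + 1)) (x (n + 2)) :=
    (hle _ (mem_univ _)).trans
      (mul_le_mul_of_nonneg_left (hx.max_infDist_le h hA' hB' hA hB hAB n) hk.le)
  obtain ⟨α, hα₀, hα₁, hα⟩ := hy.exists_infDist_le_geometric h hAB hk hstep
  obtain ⟨p, hp, hlin⟩ := (hy.fejerMonotone h).exists_convergesLinearly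
    (isComplete_inter hA' hB'.isClosed) hAB hα₀ hα₁ hα
  exact ⟨p, hp, hlin.of_succ⟩

end IsAlternatingProjection

end AlternatingProjection

end CATSpace

theorem theorem3p6_general {M : Type*} [MetricSpace M] {κ : ℝ} (hκ : 0 < κ)
    (hM : CATSpace.IsCAT κ M)
    (hdiam : Metric.ediam (Set.univ : Set M) < ENNReal.ofReal (CATSpace.modelDiam κ / 2))
    {A B : Set M} (hA' : IsComplete A) (hB' : IsComplete B)
    (hA : CATSpace.IsGeodesicallyConvex A) (hB : CATSpace.IsGeodesicallyConvex B)
    (hAB : (A ∩ B).Nonempty)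
    {x : ℕ → M} (hx : CATSpace.IsAlternatingProjection A B x) :
    (∃ p ∈ A ∩ B, CATSpace.DeltaConverges x p) ∧
    (CATSpace.BoundedlyRegular A B → ∃ p ∈ A ∩ B, Tendsto x atTop (𝓝 p)) ∧
    (CATSpace.BoundedlyLinearlyRegular A B → ∃ p ∈ A ∩ B, CATSpace.ConvergesLinearly x p) :=
  have h := hM.isSmallCAT hκ hdiam
  ⟨hx.exists_deltaConverges h hA' hB' hA hB hAB, hx.exists_tendsto h hA' hB' hA hB hAB,
    hx.exists_convergesLinearly h hA' hB' hA hB hAB⟩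

theorem theorem3p6 {M : Type*} [MetricSpace M] [CompleteSpace M] {κ : ℝ} (hκ : 0 < κ)
    (hM : CATSpace.IsCAT κ M)
    (hdiam : Metric.ediam (Set.univ : Set M) < ENNReal.ofReal (CATSpace.modelDiam κ / 2))
    {A B : Set M} (hAc : IsClosed A) (hBc : IsClosed B)
    (hA : CATSpace.IsGeodesicallyConvex A) (hB : CATSpace.IsGeodesicallyConvex B)
    (hAB : (A ∩ B).Nonempty)
    {x : ℕ → M} (hx : CATSpace.IsAlternatingProjection A B x) :
    (∃ p ∈ A ∩ B, CATSpace.DeltaConverges x p) ∧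
    (CATSpace.BoundedlyRegular A B → ∃ p ∈ A ∩ B, Tendsto x atTop (𝓝 p)) ∧
    (CATSpace.BoundedlyLinearlyRegular A B → ∃ p ∈ A ∩ B, CATSpace.ConvergesLinearly x p) :=
  theorem3p6_general hκ hM hdiam hAc.isComplete hBc.isComplete hA hB hAB hx
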